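/- Let $X_1,X_2,\dots$ be independent identically distributed random vectors in $\mathbb R^2$ such that $\mathbb P(X_1\in h)=0$ for every affine line $h\subset\mathbb R^2$, let $S_k=X_1+\dots+X_k$ be the corresponding random walk, and let $n\ge 1$. (a) (Difference bridge.) Put $D_k=S_k-\frac{k}{n+1}S_{n+1}$ for $1\le k\le n+1$. Then $$\mathbb P\bigl(0\notin \mathrm{conv}(D_1,\dots,D_n)\bigr)=\sum_{k=1}^n\frac{1}{k(n-k+1)}.$$ (b) (Conditional bridge.) Suppose that $\mathbb P(\|S_{n+1}\|\le r)>0$ for all $r>0$, and let $B_1,\dots,B_{n+1}$ be random vectors in $\mathbb R^2$ (possibly on another probability space) such that $B_{n+1}=0$ almost surely and, for every Borel set $A\subset(\mathbb R^2)^n$, $$\mathbb P\bigl((B_1,\dots,B_n)\in A\bigr)=\lim_{r\to0+}\mathbb P\bigl((S_1,\dots,S_n)\in A \,\bigm|\, \|S_{n+1}\|\le r\bigr),$$ where the limits are assumed to exist. Then $$\mathbb P\bigl(0\notin \mathrm{conv}(B_1,\dots,B_n)\bigr)=\sum_{k=1}^n\frac{1}{k(n-k+1)}.$$ No symmetry of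 the distribution of $X_1$ is assumed. -/

import Mathlib

open MeasureTheory ProbabilityTheory Filter Topology

/-- The `k`-th partial sum `S k = X 0 + ... + X (k - 1)` of a sequence of increments. -/
def partialSum {Ω E : Type*} [AddCommMonoid E] (X : ℕ → Ω → E) (k : ℕ) (ω : Ω) : E :=
  ∑ i ∈ Finset.range k, X i ω

/-- `X 0, X 1, ...` are the increments of a random walk in `ℝ^d`: independent identically
distributed random vectors. The walk itself is `partialSum X`. -/
structure IsRandomWalkIncrements {Ω : Type*} [MeasurableSpace Ω] (μ : Measure Ω) {d : ℕ}
    (X : ℕ → Ω → EuclideanSpace ℝ (Fin d)) : Prop where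
  measurable : ∀ i, Measurable (X i)
  indep : iIndepFun X μ
  identDistrib : ∀ i, IdentDistrib (X i) (X 0) μ μ

/-- An affine hyperplane of `ℝ^d`, i.e. a level set of a nonzero linear functional. -/
def IsAffineHyperplane {d : ℕ} (h : Set (EuclideanSpace ℝ (Fin d))) : Prop :=
  ∃ u : EuclideanSpace ℝ (Fin d), u ≠ 0 ∧ ∃ c : ℝ, h = {x | inner ℝ u x = c}

/-- Condition (H): a random vector hits every given affine hyperplane with probability zero. -/
def ChargesNoHyperplane {Ω : Type*} [MeasurableSpace Ω] (μ : Measure Ω) {d : ℕ}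
    (Y : Ω → EuclideanSpace ℝ (Fin d)) : Prop :=
  ∀ h : Set (EuclideanSpace ℝ (Fin d)), IsAffineHyperplane h → μ (Y ⁻¹' h) = 0

/-- The difference bridge of length `N` of a sequence `S`: its `k`-th value is
`S k - (k / N) S N`. -/
noncomputable def differenceBridge {Ω : Type*} {d : ℕ}
    (S : ℕ → Ω → EuclideanSpace ℝ (Fin d)) (N k : ℕ) (ω : Ω) : EuclideanSpace ℝ (Fin d) :=
  S k ω - ((k : ℝ) / (N : ℝ)) • S N ω

/-- `B 1, ..., B (n + 1)`, defined on the probability space `(Ω', ν)`, is a conditional bridge of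
length `n + 1` of the walk `S` on `(Ω, μ)`: the last value is a.s. zero, and the distribution of
the values `B 1, ..., B n` is the limit, as `r → 0+`, of the conditional distributions of
`S 1, ..., S n` given `‖S (n + 1)‖ ≤ r` (a limit of distributions as set functions: the
conditional probability of every event converges). The conditioning events are required
to have positive probability. -/
structure IsConditionalBridge {Ω Ω' : Type*} [MeasurableSpace Ω] [MeasurableSpace Ω']
    (μ : Measure Ω) (ν : Measure Ω') {d : ℕ} (n : ℕ)
    (S : ℕ → Ω → EuclideanSpace ℝ (Fin d)) (B : ℕ → Ω' → EuclideanSpace ℝ (Fin d)) : Prop where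
  measurable : ∀ k ∈ Set.Icc 1 (n + 1), Measurable (B k)
  last_eq_zero : ∀ᵐ ω' ∂ν, B (n + 1) ω' = 0
  cond_pos : ∀ r : ℝ, 0 < r → 0 < μ {ω | ‖S (n + 1) ω‖ ≤ r}
  tendsto_cond : ∀ A : Set (Fin n → EuclideanSpace ℝ (Fin d)), MeasurableSet A →
    Tendsto
      (fun r : ℝ => (μ[|{ω | ‖S (n + 1) ω‖ ≤ r}]) {ω | (fun i : Fin n => S (i + 1) ω) ∈ A})
      (𝓝[>] 0) (𝓝 (ν {ω' | (fun i : Fin n => B (i + 1) ω') ∈ A}))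

/-! Both bridges are closed polygons with vertices `0, V 1, ..., V n, 0` whose `n + 1` edges are
exchangeable and whose vertices are a.s. in general position; nothing else about the law matters.
The origin lies outside the hull of `V 1, ..., V n` exactly when some `V k`, necessarily unique, has
all other `V j` strictly to its left, i.e. is the clockwise-most vertex seen from the origin. The
answer is therefore the sum over `k` of the probabilities of `leftOfChord`. For fixed `k`, the cross
products of `V k` with the first `k` edges sum to zero, and so do those with the last `n + 1 - k`
edges. Rotating each block cyclically leaves `V k` unchanged, and by the cycle lemma
(`existsUnique_rotate_pos`) exactly one of the `k (n + 1 - k)` pairs of rotations makes all proper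
partial sums positive. By exchangeability these pairs give equally likely events, so each has
probability `1 / (k (n + 1 - k))`. It remains to verify exchangeability and general position: for
the difference bridge by centering the increments, for the conditional bridge by a limit over
thickenings of closed sets. -/

/-! ### Planar geometry: the origin and convex hulls. -/

/-- The planar cross product `v₀ w₁ - v₁ w₀`, linear in the second argument. -/
def planarCross (v : EuclideanSpace ℝ (Fin 2)) : EuclideanSpace ℝ (Fin 2) →ₗ[ℝ] ℝ where
  toFun w := v 0 * w 1 - v 1 * w 0
  map_add' x y := by simp; ring
  map_smul' c x := by simp; ring

theorem planarCross_apply (v w : EuclideanSpace ℝ (Fin 2)) :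
    planarCross v w = v 0 * w 1 - v 1 * w 0 := rfl

theorem planarCross_self (v : EuclideanSpace ℝ (Fin 2)) : planarCross v v = 0 := by
  rw [planarCross_apply]; ring

theorem planarCross_swap (v w : EuclideanSpace ℝ (Fin 2)) :
    planarCross v w = -planarCross w v := by
  simp only [planarCross_apply]; ring

theorem measurable_planarCross :
    Measurable fun p : EuclideanSpace ℝ (Fin 2) × EuclideanSpace ℝ (Fin 2) =>
      planarCross p.1 p.2 := by
  simp only [planarCross_apply]
  fun_prop

theorem inner_plane (v w : EuclideanSpace ℝ (Fin 2)) :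
    inner ℝ v w = v 0 * w 0 + v 1 * w 1 := by
  simp [PiLp.inner_apply, Fin.sum_univ_two]; ring

theorem plane_ext {v w : EuclideanSpace ℝ (Fin 2)} (h0 : v 0 = w 0) (h1 : v 1 = w 1) : v = w := by
  ext i; fin_cases i <;> assumption

/-- The half-plane to the left of `v`, together with the open ray through `v`, is convex. -/
theorem convex_left_of (v : EuclideanSpace ℝ (Fin 2)) :
    Convex ℝ {x | 0 < planarCross v x ∨ (planarCross v x = 0 ∧ 0 < inner ℝ v x)} := by
  intro x hx y hy a b ha hb hab
  simp only [Set.mem_ofPred_eq, map_add, map_smul, smul_eq_mul, inner_add_right,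
    inner_smul_right] at *
  rcases ha.eq_or_lt with rfl | ha
  · obtain rfl : b = 1 := by linarith
    simpa using hy
  rcases hb.eq_or_lt with rfl | hb
  · obtain rfl : a = 1 := by linarith
    simpa using hx
  rcases hx with hx | ⟨hx, hx'⟩ <;> rcases hy with hy | ⟨hy, hy'⟩
  · left; positivity
  · left; rw [hy]; simpa using mul_pos ha hx
  · left; rw [hx]; simpa using mul_pos hb hy
  · right; rw [hx, hy]; exact ⟨by simp, by positivity⟩

/-- The points lie in an open half-plane enlarged by the open ray through `v k`, a convex set that
misses the origin. -/
theorem zero_notMem_convexHull_of_cross_pos {s : Set ℕ} {v : ℕ → EuclideanSpace ℝ (Fin 2)} {k : ℕ}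
    (hk : v k ≠ 0) (h : ∀ j ∈ s, j ≠ k → 0 < planarCross (v k) (v j)) :
    (0 : EuclideanSpace ℝ (Fin 2)) ∉ convexHull ℝ (v '' s) := by
  intro h0
  have hsub : v '' s ⊆
      {x | 0 < planarCross (v k) x ∨ (planarCross (v k) x = 0 ∧ 0 < inner ℝ (v k) x)} := by
    rintro _ ⟨j, hj, rfl⟩
    by_cases hjk : j = k
    · subst hjk
      exact Or.inr ⟨planarCross_self _, real_inner_self_pos.2 hk⟩
    · exact Or.inl (h j hj hjk)
  simpa using convexHull_min hsub (convex_left_of (v k)) h0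

theorem exists_cross_pos_of_zero_notMem_convexHull {s : Set ℕ} (hs : s.Finite) (hne : s.Nonempty)
    {v : ℕ → EuclideanSpace ℝ (Fin 2)}
    (hv : ∀ i ∈ s, ∀ j ∈ s, i ≠ j → planarCross (v i) (v j) ≠ 0)
    (h0 : (0 : EuclideanSpace ℝ (Fin 2)) ∉ convexHull ℝ (v '' s)) :
    ∃ k ∈ s, ∀ j ∈ s, j ≠ k → 0 < planarCross (v k) (v j) := by
  obtain ⟨f, u, hfu, hf⟩ := geometric_hahn_banach_point_closed (convex_convexHull ℝ (v '' s))
    ((hs.image v).isCompact_convexHull (𝕜 := ℝ)).isClosed h0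
  obtain ⟨w, rfl⟩ := (InnerProductSpace.toDual ℝ (EuclideanSpace ℝ (Fin 2))).surjective f
  rw [map_zero] at hfu
  have hpos : ∀ j ∈ s, 0 < inner ℝ w (v j) := fun j hj => by
    have := hf (v j) (subset_convexHull ℝ _ ⟨j, hj, rfl⟩)
    rw [InnerProductSpace.toDual_apply_apply] at this
    linarith
  -- All points lie in the open half-plane around the separating normal `w`; the ratio is the
  -- tangent of the angle from `w`, so `k` is the clockwise-most point.
  obtain ⟨k, hk, hmin⟩ := hs.exists_minimalFor
    (fun j => planarCross w (v j) / inner ℝ w (v j)) s hne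
  refine ⟨k, hk, fun j hj hjk => lt_of_le_of_ne ?_ (hv k hk j hj hjk.symm).symm⟩
  have hle : planarCross w (v k) / inner ℝ w (v k) ≤ planarCross w (v j) / inner ℝ w (v j) := by
    rcases le_total (planarCross w (v k) / inner ℝ w (v k))
      (planarCross w (v j) / inner ℝ w (v j)) with h | h
    · exact h
    · exact hmin hj h
  rw [div_le_div_iff₀ (hpos k hk) (hpos j hj)] at hle
  have hw : 0 < inner ℝ w w := real_inner_self_pos.2 (by
    rintro rfl
    simpa using hpos k hk)
  -- Uses `|w|² (v × v') = ⟨w, v⟩ (w × v') - (w × v) ⟨w, v'⟩`.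
  refine nonneg_of_mul_nonneg_right ?_ hw
  rw [inner_plane w w]
  simp only [planarCross_apply, inner_plane] at hle ⊢
  linarith

/-! ### The cycle lemma and block rotations. -/

/-- Partial sums of a rotated sequence, when the full period sums to zero. -/
theorem sum_range_rotate {M : Type*} [AddCommGroup M] (y : ℕ → M) {k a : ℕ} (ha : a < k)
    (h0 : ∑ i ∈ Finset.range k, y i = 0) (j : ℕ) :
    ∑ i ∈ Finset.range j, y ((i + a) % k)
      = ∑ i ∈ Finset.range ((j + a) % k), y i - ∑ i ∈ Finset.range a, y i := by
  induction j with
  | zero => simp [Nat.mod_eq_of_lt ha]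
  | succ j ih =>
    have hk : 0 < k := by omega
    rw [Finset.sum_range_succ, ih]
    have hlt := Nat.mod_lt (j + a) hk
    have hmod : (j + 1 + a) % k = ((j + a) % k + 1) % k := by
      rw [Nat.mod_add_mod]; congr 1; omega
    have : ∑ i ∈ Finset.range ((j + 1 + a) % k), y i
        = ∑ i ∈ Finset.range ((j + a) % k + 1), y i := by
      rw [hmod]
      rcases (Nat.succ_le_of_lt hlt).eq_or_lt with h | h
      · rw [Nat.succ_eq_add_one] at h
        rw [h, h0]; simp
      · rw [Nat.mod_eq_of_lt h]
    rw [this, Finset.sum_range_succ]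
    abel

/-- The cycle lemma: a cyclic sequence of sum zero in general position has exactly one rotation
with positive partial sums. -/
theorem existsUnique_rotate_pos {y : ℕ → ℝ} {k : ℕ} (hk : 0 < k)
    (h0 : ∑ i ∈ Finset.range k, y i = 0)
    (hne : ∀ a < k, ∀ j, 0 < j → j < k → ∑ i ∈ Finset.range j, y ((i + a) % k) ≠ 0) :
    ∃! a, a < k ∧ ∀ j, 0 < j → j < k → 0 < ∑ i ∈ Finset.range j, y ((i + a) % k) := by
  -- The right starting point is where the partial sums are minimal.
  obtain ⟨a, ha, hmin⟩ := Finset.exists_min_image (Finset.range k)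
    (fun a => ∑ i ∈ Finset.range a, y i) ⟨0, Finset.mem_range.2 hk⟩
  rw [Finset.mem_range] at ha
  refine ⟨a, ⟨ha, fun j hj hjk => lt_of_le_of_ne ?_ (hne a ha j hj hjk).symm⟩, ?_⟩
  · rw [sum_range_rotate y ha h0]
    exact sub_nonneg.2 (hmin _ (Finset.mem_range.2 (Nat.mod_lt _ hk)))
  · rintro b ⟨hb, hpos⟩
    by_contra hba
    -- Another valid start `b` passes through `a` after `j` steps, so the sum at `a` would exceed
    -- the sum at `b`, against minimality.
    have hj : ∃ j, 0 < j ∧ j < k ∧ (j + b) % k = a := by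
      rcases lt_or_gt_of_ne hba with h | h
      · exact ⟨a - b, by omega, by omega, by rw [Nat.sub_add_cancel h.le, Nat.mod_eq_of_lt ha]⟩
      · refine ⟨a + k - b, by omega, by omega, ?_⟩
        rw [Nat.sub_add_cancel (by omega), Nat.add_mod_right, Nat.mod_eq_of_lt ha]
    obtain ⟨j, hj0, hjk, hja⟩ := hj
    have h1 := hpos j hj0 hjk
    rw [sum_range_rotate y hb h0, hja] at h1
    have h2 := hmin b (Finset.mem_range.2 hb)
    linarith

/-- The rotation of `0, ..., N - 1` that shifts the block `0, ..., k - 1` cyclically by `a` and the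
block `k, ..., N - 1` cyclically by `b`. -/
def blockRotation (k N a b i : ℕ) : ℕ :=
  if i < k then (i + a) % k else k + (i - k + b) % (N - k)

theorem add_mod_injOn (k a : ℕ) : Set.InjOn (fun i => (i + a) % k) (Set.Iio k) := by
  intro i hi j hj h
  exact (Nat.ModEq.add_right_cancel' a h).eq_of_lt_of_lt hi hj

theorem blockRotation_bijOn {k N : ℕ} (hk : 0 < k) (hkN : k < N) (a b : ℕ) :
    Set.BijOn (blockRotation k N a b) (Set.Iio N) (Set.Iio N) := by
  have hmaps : Set.MapsTo (blockRotation k N a b) (Set.Iio N) (Set.Iio N) := by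
    intro i hi
    have h1 := Nat.mod_lt (i + a) hk
    have h2 := Nat.mod_lt (i - k + b) (Nat.sub_pos_of_lt hkN)
    simp only [blockRotation, Set.mem_Iio] at *
    split_ifs <;> omega
  have hinj : Set.InjOn (blockRotation k N a b) (Set.Iio N) := by
    intro i hi j hj h
    have h1 := Nat.mod_lt (i + a) hk
    have h2 := Nat.mod_lt (j + a) hk
    simp only [blockRotation, Set.mem_Iio] at *
    split_ifs at h with hik hjk hjk
    · exact add_mod_injOn k a hik hjk h
    · omega
    · omega
    · have := add_mod_injOn (N - k) b (show i - k < N - k by omega) (show j - k < N - k by omega)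
        (Nat.add_left_cancel h)
      omega
  exact ((Set.finite_Iio N).injOn_iff_bijOn_of_mapsTo hmaps).1 hinj

theorem sum_range_bijOn {M : Type*} [AddCommMonoid M] {σ : ℕ → ℕ} {N : ℕ}
    (hσ : Set.BijOn σ (Set.Iio N) (Set.Iio N)) (x : ℕ → M) :
    ∑ i ∈ Finset.range N, x (σ i) = ∑ i ∈ Finset.range N, x i :=
  Finset.sum_nbij σ (fun i hi => Finset.mem_range.2 (hσ.mapsTo (Finset.mem_range.1 hi)))
    (by simpa using hσ.injOn) (by simpa using hσ.surjOn) (fun _ _ => rfl)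

/-! ### Exchangeable sequences and the chord events. -/

theorem measurable_partialSum {Ω E : Type*} [MeasurableSpace Ω] [AddCommMonoid E]
    [MeasurableSpace E] [MeasurableAdd₂ E] {X : ℕ → Ω → E} (hX : ∀ i, Measurable (X i)) (k : ℕ) :
    Measurable (partialSum X k) := by
  unfold partialSum
  exact Finset.measurable_sum _ fun i _ => hX i

theorem partialSum_congr {Ω Ω' E : Type*} [AddCommMonoid E] {X : ℕ → Ω → E} {Y : ℕ → Ω' → E}
    {k : ℕ} {ω : Ω} {ω' : Ω'} (h : ∀ i < k, X i ω = Y i ω') :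
    partialSum X k ω = partialSum Y k ω' :=
  Finset.sum_congr rfl fun i hi => h i (Finset.mem_range.1 hi)

/-- The law of `Y 0, ..., Y (N - 1)` is invariant under permutations. -/
def IsExchangeable {Ω E : Type*} [MeasurableSpace Ω] [MeasurableSpace E] (μ : Measure Ω) (N : ℕ)
    (Y : ℕ → Ω → E) : Prop :=
  ∀ σ : ℕ → ℕ, Set.BijOn σ (Set.Iio N) (Set.Iio N) →
    IdentDistrib (fun ω (i : Fin N) => Y (σ i) ω) (fun ω (i : Fin N) => Y i ω) μ μ

/-- A finite sequence extended by zero. -/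
def extendZero {E : Type*} [Zero E] (N i : ℕ) (y : Fin N → E) : E :=
  if h : i < N then y ⟨i, h⟩ else 0

theorem measurable_extendZero {E : Type*} [Zero E] [MeasurableSpace E] (N i : ℕ) :
    Measurable (extendZero (E := E) N i) := by
  unfold extendZero
  split_ifs
  · exact measurable_pi_apply _
  · exact measurable_const

/-- `extendZero N` acts as the coordinate process on `Fin N → E`, so events about partial sums
become preimages of sets of finite vectors, to which equality of laws applies. -/
theorem partialSum_extendZero {Ω E : Type*} [AddCommMonoid E] (X : ℕ → Ω → E) {N k : ℕ}
    (hk : k ≤ N) (ω : Ω) :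
    partialSum (extendZero N) k (fun i : Fin N => X i ω) = partialSum X k ω :=
  partialSum_congr fun i hi => by simp [extendZero, hi.trans_le hk]

/-- All vertices of the closed polygon, other than the origin and the `k`-th one, lie to the left
of the chord from the origin to the `k`-th vertex. -/
def leftOfChord {Ω : Type*} (Y : ℕ → Ω → EuclideanSpace ℝ (Fin 2)) (n k : ℕ) : Set Ω :=
  {ω | ∀ j ∈ Finset.Icc 1 n, j ≠ k → 0 < planarCross (partialSum Y k ω) (partialSum Y j ω)}

theorem measurable_cross_partialSum {Ω : Type*} [MeasurableSpace Ω]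
    {Y : ℕ → Ω → EuclideanSpace ℝ (Fin 2)} (hY : ∀ i, Measurable (Y i)) (k j : ℕ) :
    Measurable fun ω => planarCross (partialSum Y k ω) (partialSum Y j ω) :=
  measurable_planarCross.comp ((measurable_partialSum hY k).prodMk (measurable_partialSum hY j))

theorem measurableSet_leftOfChord {Ω : Type*} [MeasurableSpace Ω]
    {Y : ℕ → Ω → EuclideanSpace ℝ (Fin 2)} (hY : ∀ i, Measurable (Y i)) (n k : ℕ) :
    MeasurableSet (leftOfChord Y n k) := by
  have : leftOfChord Y n k = ⋂ j ∈ Finset.Icc 1 n, ⋂ (_ : j ≠ k),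
      {ω | 0 < planarCross (partialSum Y k ω) (partialSum Y j ω)} := by
    ext ω; simp [leftOfChord]
  rw [this]
  exact Finset.measurableSet_biInter _ fun j _ => MeasurableSet.iInter fun _ =>
    measurableSet_lt measurable_const (measurable_cross_partialSum hY k j)

theorem leftOfChord_eq_preimage {Ω : Type*} (Y : ℕ → Ω → EuclideanSpace ℝ (Fin 2)) {n k : ℕ}
    (hk : k ≤ n) :
    leftOfChord Y n k = (fun ω (i : Fin (n + 1)) => Y i ω) ⁻¹'
      leftOfChord (extendZero (n + 1)) n k := by
  ext ω
  simp only [leftOfChord, Set.mem_preimage, Set.mem_ofPred_eq]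
  refine forall₂_congr fun j hj => ?_
  rw [Finset.mem_Icc] at hj
  rw [partialSum_extendZero Y (by omega) ω, partialSum_extendZero Y (by omega) ω]

theorem IsExchangeable.measure_leftOfChord {Ω : Type*} [MeasurableSpace Ω] {μ : Measure Ω}
    {Y : ℕ → Ω → EuclideanSpace ℝ (Fin 2)} {n : ℕ} (hY : IsExchangeable μ (n + 1) Y) {σ : ℕ → ℕ}
    (hσ : Set.BijOn σ (Set.Iio (n + 1)) (Set.Iio (n + 1))) {k : ℕ} (hk : k ≤ n) :
    μ (leftOfChord (fun i => Y (σ i)) n k) = μ (leftOfChord Y n k) := by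
  rw [leftOfChord_eq_preimage Y hk, leftOfChord_eq_preimage (fun i => Y (σ i)) hk]
  exact (hY σ hσ).measure_mem_eq
    (measurableSet_leftOfChord (fun i => measurable_extendZero _ i) n k)

theorem IsExchangeable.ae_cross_ne_zero {Ω : Type*} [MeasurableSpace Ω] {μ : Measure Ω}
    {Y : ℕ → Ω → EuclideanSpace ℝ (Fin 2)} {N : ℕ} (hY : IsExchangeable μ N Y) {σ : ℕ → ℕ}
    (hσ : Set.BijOn σ (Set.Iio N) (Set.Iio N)) {k j : ℕ} (hk : k ≤ N) (hj : j ≤ N)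
    (h : ∀ᵐ ω ∂μ, planarCross (partialSum Y k ω) (partialSum Y j ω) ≠ 0) :
    ∀ᵐ ω ∂μ, planarCross (partialSum (fun i => Y (σ i)) k ω)
      (partialSum (fun i => Y (σ i)) j ω) ≠ 0 := by
  have hm : MeasurableSet {y : Fin N → EuclideanSpace ℝ (Fin 2) |
      planarCross (partialSum (extendZero N) k y) (partialSum (extendZero N) j y) ≠ 0} :=
    (measurable_cross_partialSum (fun i => measurable_extendZero _ i) k j)
      (measurableSet_singleton 0).compl
  have := (hY σ hσ).symm.ae_mem_snd hm (by
    filter_upwards [h] with ω hω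
    simpa only [Set.mem_ofPred_eq, partialSum_extendZero Y hk, partialSum_extendZero Y hj] using hω)
  filter_upwards [this] with ω hω
  simpa only [Set.mem_ofPred_eq, partialSum_extendZero (fun i => Y (σ i)) hk,
    partialSum_extendZero (fun i => Y (σ i)) hj] using hω

/-! ### Block rotations of a fixed closed polygon. -/

section Rotation

variable {Ω : Type*} {Y : ℕ → Ω → EuclideanSpace ℝ (Fin 2)} {n k a b : ℕ} {ω : Ω}

theorem cross_partialSum (v : EuclideanSpace ℝ (Fin 2)) (Y : ℕ → Ω → EuclideanSpace ℝ (Fin 2))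
    (j : ℕ) (ω : Ω) :
    planarCross v (partialSum Y j ω) = ∑ i ∈ Finset.range j, planarCross v (Y i ω) :=
  map_sum _ _ _

/-- The first block is only permuted within itself, so all rotations share the same chord. -/
theorem partialSum_blockRotation (hk : 0 < k) :
    partialSum (fun i => Y (blockRotation k (n + 1) a b i)) k ω = partialSum Y k ω := by
  have hσ : Set.BijOn (fun i => (i + a) % k) (Set.Iio k) (Set.Iio k) :=
    ((Set.finite_Iio k).injOn_iff_bijOn_of_mapsTo fun i _ => Nat.mod_lt _ hk).1 (add_mod_injOn k a)
  unfold partialSum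
  rw [← sum_range_bijOn hσ fun i => Y i ω]
  refine Finset.sum_congr rfl fun i hi => ?_
  simp [blockRotation, Finset.mem_range.1 hi]

theorem cross_blockRotation_left (v : EuclideanSpace ℝ (Fin 2)) {j : ℕ} (hj : j ≤ k) :
    planarCross v (partialSum (fun i => Y (blockRotation k (n + 1) a b i)) j ω)
      = ∑ i ∈ Finset.range j, planarCross v (Y ((i + a) % k) ω) := by
  rw [cross_partialSum]
  refine Finset.sum_congr rfl fun i hi => ?_
  simp [blockRotation, (Finset.mem_range.1 hi).trans_le hj]

/-- The first block adds up to the chord itself, which the cross product kills. -/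
theorem cross_blockRotation_right (hk : 0 < k) (m : ℕ) :
    planarCross (partialSum Y k ω)
        (partialSum (fun i => Y (blockRotation k (n + 1) a b i)) (k + m) ω)
      = ∑ i ∈ Finset.range m,
          planarCross (partialSum Y k ω) (Y (k + (i + b) % (n + 1 - k)) ω) := by
  rw [cross_partialSum, Finset.sum_range_add, ← cross_partialSum _ (fun i =>
    Y (blockRotation k (n + 1) a b i)), partialSum_blockRotation hk, planarCross_self, zero_add]
  refine Finset.sum_congr rfl fun i _ => ?_
  simp [blockRotation]

/-- Exactly one block rotation of a closed polygon in general position puts all other vertices to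
the left of the `k`-th chord. -/
theorem existsUnique_blockRotation_mem_leftOfChord (hk : k ∈ Finset.Icc 1 n)
    (h0 : partialSum Y (n + 1) ω = 0)
    (hne : ∀ a < k, ∀ b < n + 1 - k, ∀ j ∈ Finset.Icc 1 n, j ≠ k →
      planarCross (partialSum (fun i => Y (blockRotation k (n + 1) a b i)) k ω)
        (partialSum (fun i => Y (blockRotation k (n + 1) a b i)) j ω) ≠ 0) :
    ∃! p : ℕ × ℕ, p ∈ Finset.range k ×ˢ Finset.range (n + 1 - k) ∧
      ω ∈ leftOfChord (fun i => Y (blockRotation k (n + 1) p.1 p.2 i)) n k := by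
  rw [Finset.mem_Icc] at hk
  have hk0 : 0 < k := hk.1
  simp only [partialSum_blockRotation hk0] at hne
  -- The event decouples: vertices before `k` depend only on `a`, vertices after `k` only on `b`.
  have hmem : ∀ a b, ω ∈ leftOfChord (fun i => Y (blockRotation k (n + 1) a b i)) n k ↔
      (∀ j, 0 < j → j < k → 0 < ∑ i ∈ Finset.range j,
        planarCross (partialSum Y k ω) (Y ((i + a) % k) ω)) ∧
      (∀ m, 0 < m → m < n + 1 - k → 0 < ∑ i ∈ Finset.range m,
        planarCross (partialSum Y k ω) (Y (k + (i + b) % (n + 1 - k)) ω)) := by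
    intro a b
    simp only [leftOfChord, Set.mem_ofPred_eq, partialSum_blockRotation hk0]
    constructor
    · refine fun h => ⟨fun j hj hjk => ?_, fun m hm hmk => ?_⟩
      · rw [← cross_blockRotation_left (n := n) (b := b) _ hjk.le]
        exact h j (Finset.mem_Icc.2 ⟨hj, by omega⟩) hjk.ne
      · rw [← cross_blockRotation_right (a := a) hk0]
        exact h _ (Finset.mem_Icc.2 ⟨by omega, by omega⟩) (by omega)
    · rintro ⟨h1, h2⟩ j hj hjk
      rw [Finset.mem_Icc] at hj
      rcases lt_or_gt_of_ne hjk with h | h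
      · rw [cross_blockRotation_left _ h.le]
        exact h1 j hj.1 h
      · obtain ⟨m, rfl⟩ := Nat.exists_eq_add_of_le h.le
        rw [cross_blockRotation_right hk0]
        exact h2 m (by omega) (by omega)
  have hs1 : ∑ i ∈ Finset.range k, planarCross (partialSum Y k ω) (Y i ω) = 0 := by
    rw [← cross_partialSum, planarCross_self]
  have hs2 : ∑ i ∈ Finset.range (n + 1 - k), planarCross (partialSum Y k ω) (Y (k + i) ω) = 0 := by
    have h := cross_partialSum (partialSum Y k ω) Y (k + (n + 1 - k)) ω
    rw [Finset.sum_range_add, hs1, zero_add, show k + (n + 1 - k) = n + 1 by omega, h0,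
      map_zero] at h
    exact h.symm
  obtain ⟨a, ⟨hak, ha⟩, hau⟩ := existsUnique_rotate_pos hk0 hs1 fun a ha j hj hjk => by
    rw [← cross_blockRotation_left (n := n) (b := 0) _ hjk.le]
    exact hne a ha 0 (by omega) j (Finset.mem_Icc.2 ⟨hj, by omega⟩) hjk.ne
  obtain ⟨b, ⟨hbk, hb⟩, hbu⟩ := existsUnique_rotate_pos
    (y := fun i => planarCross (partialSum Y k ω) (Y (k + i) ω)) (by omega) hs2
    fun b hb m hm hmk => by
      rw [← cross_blockRotation_right (a := 0) hk0]
      exact hne 0 hk0 b hb _ (Finset.mem_Icc.2 ⟨by omega, by omega⟩) (by omega)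
  refine ⟨(a, b), ⟨by simp [hak, hbk], (hmem a b).2 ⟨ha, hb⟩⟩, ?_⟩
  rintro ⟨a', b'⟩ ⟨hp, hp'⟩
  simp only [Finset.mem_product, Finset.mem_range] at hp
  obtain ⟨h1, h2⟩ := (hmem a' b').1 hp'
  rw [hau a' ⟨hp.1, h1⟩, hbu b' ⟨hp.2, h2⟩]

end Rotation

/-! ### The distribution-free probability for exchangeable polygons. -/

theorem sum_measure_eq_one_of_ae_existsUnique {Ω ι : Type*} [MeasurableSpace Ω] {μ : Measure Ω}
    [IsProbabilityMeasure μ] {s : Finset ι} {E : ι → Set Ω} (hE : ∀ i, MeasurableSet (E i))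
    (h : ∀ᵐ ω ∂μ, ∃! i, i ∈ s ∧ ω ∈ E i) : ∑ i ∈ s, μ (E i) = 1 := by
  calc ∑ i ∈ s, μ (E i) = ∫⁻ ω, ∑ i ∈ s, (E i).indicator 1 ω ∂μ := by
        rw [lintegral_finsetSum _ fun i _ => measurable_one.indicator (hE i)]
        exact Finset.sum_congr rfl fun i _ => (lintegral_indicator_one (hE i)).symm
    _ = ∫⁻ _, 1 ∂μ := by
        refine lintegral_congr_ae ?_
        filter_upwards [h] with ω hω
        obtain ⟨i, ⟨his, hi⟩, hu⟩ := hω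
        rw [Finset.sum_eq_single i, Set.indicator_of_mem hi, Pi.one_apply]
        · exact fun j hj hji => Set.indicator_of_notMem (fun hjE => hji (hu j ⟨hj, hjE⟩)) _
        · exact fun h => absurd his h
    _ = 1 := by simp

theorem measureReal_leftOfChord {Ω : Type*} [MeasurableSpace Ω] {μ : Measure Ω}
    [IsProbabilityMeasure μ] {Y : ℕ → Ω → EuclideanSpace ℝ (Fin 2)} {n : ℕ}
    (hYm : ∀ i, Measurable (Y i)) (hY : IsExchangeable μ (n + 1) Y)
    (h0 : ∀ᵐ ω ∂μ, partialSum Y (n + 1) ω = 0)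
    (hcross : ∀ i ∈ Finset.Icc 1 n, ∀ j ∈ Finset.Icc 1 n, i ≠ j →
      ∀ᵐ ω ∂μ, planarCross (partialSum Y i ω) (partialSum Y j ω) ≠ 0)
    {k : ℕ} (hk : k ∈ Finset.Icc 1 n) :
    μ.real (leftOfChord Y n k) = 1 / ((k : ℝ) * ((n : ℝ) - (k : ℝ) + 1)) := by
  have hk' := Finset.mem_Icc.1 hk
  have hσ := fun a b => blockRotation_bijOn (N := n + 1) hk'.1 (by omega) a b
  have hsum := sum_measure_eq_one_of_ae_existsUnique (μ := μ)
    (s := Finset.range k ×ˢ Finset.range (n + 1 - k))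
    (E := fun p => leftOfChord (fun i => Y (blockRotation k (n + 1) p.1 p.2 i)) n k)
    (fun p => measurableSet_leftOfChord (fun i => hYm _) n k) (by
      have hne : ∀ a b : ℕ, ∀ j, j ∈ Finset.Icc 1 n → j ≠ k → ∀ᵐ ω ∂μ,
          planarCross (partialSum (fun i => Y (blockRotation k (n + 1) a b i)) k ω)
            (partialSum (fun i => Y (blockRotation k (n + 1) a b i)) j ω) ≠ 0 :=
        fun a b j hj hjk => hY.ae_cross_ne_zero (hσ a b) (by omega)
          (by rw [Finset.mem_Icc] at hj; omega) (hcross k hk j hj hjk.symm)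
      simp only [← ae_all_iff] at hne
      filter_upwards [h0, hne] with ω hω0 hω
      exact existsUnique_blockRotation_mem_leftOfChord hk hω0 fun a _ b _ => hω a b)
  -- All `k (n + 1 - k)` summands equal the probability of the unrotated event.
  simp only [hY.measure_leftOfChord (hσ _ _) hk'.2, Finset.sum_const, Finset.card_product,
    Finset.card_range, nsmul_eq_mul] at hsum
  have hreal := congrArg ENNReal.toReal hsum
  rw [ENNReal.toReal_mul, ENNReal.toReal_natCast, ENNReal.toReal_one, Nat.cast_mul,
    Nat.cast_sub (by omega)] at hreal
  have hkn : (0 : ℝ) < (k : ℝ) * ((n : ℝ) - k + 1) := by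
    have h1 : (1 : ℝ) ≤ k := by exact_mod_cast hk'.1
    have h2 : (k : ℝ) ≤ n := by exact_mod_cast hk'.2
    have h3 : (0 : ℝ) < (n : ℝ) - k + 1 := by linarith
    positivity
  rw [eq_div_iff hkn.ne', Measure.real]
  push_cast at hreal
  linarith

/-- The origin is a vertex of an exchangeable closed polygon in general position with a
distribution-free probability. -/
theorem measureReal_zero_notMem_convexHull {Ω : Type*} [MeasurableSpace Ω] {μ : Measure Ω}
    [IsProbabilityMeasure μ] {Y : ℕ → Ω → EuclideanSpace ℝ (Fin 2)} {n : ℕ} (hn : 1 ≤ n)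
    (hYm : ∀ i, Measurable (Y i)) (hY : IsExchangeable μ (n + 1) Y)
    (h0 : ∀ᵐ ω ∂μ, partialSum Y (n + 1) ω = 0)
    (hne : ∀ i ∈ Finset.Icc 1 n, ∀ᵐ ω ∂μ, partialSum Y i ω ≠ 0)
    (hcross : ∀ i ∈ Finset.Icc 1 n, ∀ j ∈ Finset.Icc 1 n, i ≠ j →
      ∀ᵐ ω ∂μ, planarCross (partialSum Y i ω) (partialSum Y j ω) ≠ 0) :
    μ.real {ω | (0 : EuclideanSpace ℝ (Fin 2)) ∉
        convexHull ℝ ((fun k => partialSum Y k ω) '' Set.Icc 1 n)}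
      = ∑ k ∈ Finset.Icc 1 n, 1 / ((k : ℝ) * ((n : ℝ) - (k : ℝ) + 1)) := by
  have hae : {ω | (0 : EuclideanSpace ℝ (Fin 2)) ∉
      convexHull ℝ ((fun k => partialSum Y k ω) '' Set.Icc 1 n)}
        =ᵐ[μ] ⋃ k ∈ Finset.Icc 1 n, leftOfChord Y n k := by
    have hne' : ∀ᵐ ω ∂μ, ∀ i ∈ Finset.Icc 1 n, partialSum Y i ω ≠ 0 :=
      (Finset.eventually_all _).2 hne
    have hcross' : ∀ᵐ ω ∂μ, ∀ i, i ∈ Finset.Icc 1 n → ∀ j, j ∈ Finset.Icc 1 n → i ≠ j →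
        planarCross (partialSum Y i ω) (partialSum Y j ω) ≠ 0 := by
      simpa only [ae_all_iff] using hcross
    filter_upwards [hne', hcross'] with ω h1 h2
    apply propext
    change (_ ∉ _) ↔ ω ∈ (⋃ k ∈ Finset.Icc 1 n, leftOfChord Y n k)
    simp only [Set.mem_iUnion, exists_prop]
    constructor
    · intro h
      obtain ⟨k, hk, hk'⟩ := exists_cross_pos_of_zero_notMem_convexHull (Set.finite_Icc 1 n)
        ⟨1, Set.mem_Icc.2 ⟨le_rfl, hn⟩⟩
        (fun i hi j hj hij => h2 i (Finset.mem_Icc.2 hi) j (Finset.mem_Icc.2 hj) hij) h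
      exact ⟨k, Finset.mem_Icc.2 hk, fun j hj hjk => hk' j (Finset.mem_Icc.1 hj) hjk⟩
    · rintro ⟨k, hk, hk'⟩
      exact zero_notMem_convexHull_of_cross_pos (v := fun k => partialSum Y k ω) (h1 k hk)
        fun j hj hjk => hk' j (Finset.mem_Icc.2 hj) hjk
  rw [measureReal_congr hae, measureReal_biUnion_finset]
  · exact Finset.sum_congr rfl fun k hk => measureReal_leftOfChord hYm hY h0 hcross hk
  -- Two vertices cannot each lie to the left of the other, by antisymmetry.
  · intro i hi j hj hij
    refine Set.disjoint_left.2 fun ω h1 h2 => ?_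
    have h3 := h1 j hj hij.symm
    rw [planarCross_swap] at h3
    linarith [h2 i hi hij]
  · exact fun k _ => measurableSet_leftOfChord hYm n k

/-! ### General position of the random walk. -/

theorem setOf_planarCross_isAffineHyperplane {v : EuclideanSpace ℝ (Fin 2)} (hv : v ≠ 0) (c : ℝ) :
    IsAffineHyperplane {x | planarCross v x = c} := by
  -- The normal is `v` turned by a right angle.
  refine ⟨!₂[-v 1, v 0], fun h => hv ?_, c, ?_⟩
  · have h0 := congrArg (fun x : EuclideanSpace ℝ (Fin 2) => x 0) h
    have h1 := congrArg (fun x : EuclideanSpace ℝ (Fin 2) => x 1) h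
    simp at h0 h1
    exact plane_ext h1 h0
  · ext x
    simp only [Set.mem_ofPred_eq, planarCross_apply, inner_plane]
    simp [sub_eq_neg_add]

section Walk

variable {Ω : Type*} [MeasurableSpace Ω] {μ : Measure Ω}

theorem IsRandomWalkIncrements.indepFun_prefix {d : ℕ} {X : ℕ → Ω → EuclideanSpace ℝ (Fin d)}
    (hX : IsRandomWalkIncrements μ X) (m : ℕ) :
    IndepFun (fun ω (i : Fin m) => X i ω) (X m) μ := by
  have h := hX.indep.indepFun_finset (Finset.range m) {m} (by simp) hX.measurable
  exact h.comp
    (φ := fun (y : Finset.range m → EuclideanSpace ℝ (Fin d)) (i : Fin m) =>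
      y ⟨i, Finset.mem_range.2 i.2⟩)
    (ψ := fun y : ({m} : Finset ℕ) → EuclideanSpace ℝ (Fin d) => y ⟨m, Finset.mem_singleton_self m⟩)
    (measurable_pi_lambda _ fun i => measurable_pi_apply _) (measurable_pi_apply _)

variable [IsProbabilityMeasure μ]

theorem IsRandomWalkIncrements.isExchangeable {d : ℕ} {X : ℕ → Ω → EuclideanSpace ℝ (Fin d)}
    (hX : IsRandomWalkIncrements μ X) (N : ℕ) : IsExchangeable μ N X := by
  have key : ∀ σ : ℕ → ℕ, Set.InjOn σ (Set.Iio N) →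
      μ.map (fun ω (i : Fin N) => X (σ i) ω) = Measure.pi fun _ : Fin N => μ.map (X 0) := by
    intro σ hσ
    have hind : iIndepFun (fun i : Fin N => X (σ i)) μ :=
      hX.indep.precomp (g := fun i : Fin N => σ i)
        fun i j h => Fin.ext (hσ i.2 j.2 h)
    rw [(iIndepFun_iff_map_fun_eq_pi_map fun i => (hX.measurable _).aemeasurable).1 hind]
    exact congrArg _ (funext fun i => (hX.identDistrib _).map_eq)
  intro σ hσ
  exact ⟨(measurable_pi_lambda _ fun i => hX.measurable _).aemeasurable,
    (measurable_pi_lambda _ fun i => hX.measurable _).aemeasurable,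
    (key σ hσ.injOn).trans (key id Function.injective_id.injOn).symm⟩

variable {X : ℕ → Ω → EuclideanSpace ℝ (Fin 2)}

/-- The next step of the walk avoids every line that is determined by the previous steps. -/
theorem IsRandomWalkIncrements.ae_cross_ne (hX : IsRandomWalkIncrements μ X)
    (hH : ChargesNoHyperplane μ (X 0)) {m : ℕ}
    {V : (Fin m → EuclideanSpace ℝ (Fin 2)) → EuclideanSpace ℝ (Fin 2)} (hV : Measurable V)
    {c : (Fin m → EuclideanSpace ℝ (Fin 2)) → ℝ} (hc : Measurable c)
    (hV0 : ∀ᵐ ω ∂μ, V (fun i : Fin m => X i ω) ≠ 0) :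
    ∀ᵐ ω ∂μ, planarCross (V fun i : Fin m => X i ω) (X m ω) ≠ c fun i : Fin m => X i ω := by
  have hUm : Measurable fun ω (i : Fin m) => X i ω :=
    measurable_pi_lambda _ fun i => hX.measurable _
  have hT : MeasurableSet {p : (Fin m → EuclideanSpace ℝ (Fin 2)) × EuclideanSpace ℝ (Fin 2) |
      planarCross (V p.1) p.2 = c p.1} :=
    measurableSet_eq_fun
      (measurable_planarCross.comp ((hV.comp measurable_fst).prodMk measurable_snd))
      (hc.comp measurable_fst)
  have hmap := (hX.indepFun_prefix m).map_prod_eq_prod_map_map hUm.aemeasurable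
    (hX.measurable m).aemeasurable
  have hnull : ((μ.map fun ω (i : Fin m) => X i ω).prod (μ.map (X m)))
      {p | planarCross (V p.1) p.2 = c p.1} = 0 := by
    have : IsProbabilityMeasure (μ.map (X m)) :=
      Measure.isProbabilityMeasure_map (hX.measurable m).aemeasurable
    -- Fubini: once the past is fixed, the next step must hit a fixed line.
    rw [Measure.measure_prod_null hT]
    have hV0' : ∀ᵐ y ∂(μ.map fun ω (i : Fin m) => X i ω), V y ≠ 0 :=
      (ae_map_iff hUm.aemeasurable (hV (measurableSet_singleton 0)).compl).2 hV0
    filter_upwards [hV0'] with y hy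
    rw [(hX.identDistrib m).map_eq, Measure.map_apply (hX.measurable 0) (measurable_prodMk_left hT)]
    exact hH _ (setOf_planarCross_isAffineHyperplane hy (c y))
  rw [← hmap, Measure.map_apply (hUm.prodMk (hX.measurable m)) hT] at hnull
  exact measure_eq_zero_iff_ae_notMem.1 hnull

/-- A point determined by the past lies on a line of fixed direction determined by the past. -/
theorem IsRandomWalkIncrements.ae_ne (hX : IsRandomWalkIncrements μ X)
    (hH : ChargesNoHyperplane μ (X 0)) {m : ℕ}
    {V : (Fin m → EuclideanSpace ℝ (Fin 2)) → EuclideanSpace ℝ (Fin 2)} (hV : Measurable V) :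
    ∀ᵐ ω ∂μ, X m ω ≠ V fun i : Fin m => X i ω := by
  have he : (EuclideanSpace.single 0 1 : EuclideanSpace ℝ (Fin 2)) ≠ 0 := by simp
  have h := hX.ae_cross_ne hH (m := m) (V := fun _ => EuclideanSpace.single 0 1) measurable_const
    (c := fun y => planarCross (EuclideanSpace.single 0 1) (V y))
    (measurable_planarCross.comp (measurable_const.prodMk hV)) (ae_of_all _ fun _ => he)
  filter_upwards [h] with ω hω h'
  exact hω (congrArg _ h')

theorem measurable_partialSum_extendZero (N k : ℕ) :
    Measurable (partialSum (extendZero (E := EuclideanSpace ℝ (Fin 2)) N) k) :=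
  measurable_partialSum (fun i => measurable_extendZero _ i) k

theorem partialSum_succ {Ω E : Type*} [AddCommMonoid E] (X : ℕ → Ω → E) (k : ℕ) (ω : Ω) :
    partialSum X (k + 1) ω = partialSum X k ω + X k ω :=
  Finset.sum_range_succ _ _

theorem IsRandomWalkIncrements.ae_partialSum_ne_zero (hX : IsRandomWalkIncrements μ X)
    (hH : ChargesNoHyperplane μ (X 0)) {k : ℕ} (hk : 0 < k) :
    ∀ᵐ ω ∂μ, partialSum X k ω ≠ 0 := by
  obtain ⟨m, rfl⟩ := Nat.exists_eq_succ_of_ne_zero hk.ne'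
  filter_upwards [hX.ae_ne hH (measurable_partialSum_extendZero m m).neg] with ω hω h
  rw [Nat.succ_eq_add_one, partialSum_succ] at h
  apply hω
  rw [Pi.neg_apply, partialSum_extendZero X le_rfl]
  exact eq_neg_of_add_eq_zero_right h

/-- The cross product is affine in the last step of the longer sum, with nonzero direction
`partialSum X i`. -/
theorem IsRandomWalkIncrements.ae_cross_partialSum_ne_zero (hX : IsRandomWalkIncrements μ X)
    (hH : ChargesNoHyperplane μ (X 0)) {i j : ℕ} (hi : 0 < i) (hij : i < j) :
    ∀ᵐ ω ∂μ, planarCross (partialSum X i ω) (partialSum X j ω) ≠ 0 := by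
  obtain ⟨m, rfl⟩ := Nat.exists_eq_succ_of_ne_zero (Nat.ne_zero_of_lt hij)
  have him : i ≤ m := by omega
  have h := hX.ae_cross_ne hH (measurable_partialSum_extendZero m i)
    (measurable_cross_partialSum (fun l => measurable_extendZero m l) i m).neg (by
      simpa only [partialSum_extendZero X him] using hX.ae_partialSum_ne_zero hH hi)
  filter_upwards [h] with ω hω h'
  simp only [Pi.neg_apply, partialSum_extendZero X him, partialSum_extendZero X le_rfl] at hω
  rw [Nat.succ_eq_add_one, partialSum_succ, map_add] at h'
  exact hω (eq_neg_of_add_eq_zero_right h')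

theorem IsRandomWalkIncrements.ae_smul_sub_smul_ne_zero (hX : IsRandomWalkIncrements μ X)
    (hH : ChargesNoHyperplane μ (X 0)) {i j : ℕ} (hij : i < j) {s t : ℝ} (ht : t ≠ 0) :
    ∀ᵐ ω ∂μ, s • partialSum X i ω - t • partialSum X j ω ≠ 0 := by
  obtain ⟨m, rfl⟩ := Nat.exists_eq_succ_of_ne_zero (Nat.ne_zero_of_lt hij)
  have him : i ≤ m := by omega
  filter_upwards [hX.ae_ne hH (((measurable_partialSum_extendZero m i).const_smul (t⁻¹ * s)).sub
    (measurable_partialSum_extendZero m m))] with ω hω h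
  apply hω
  simp only [Pi.sub_apply, Pi.smul_apply, partialSum_extendZero X him,
    partialSum_extendZero X le_rfl]
  rw [Nat.succ_eq_add_one, partialSum_succ, sub_eq_zero, ← inv_smul_eq_iff₀ ht, smul_smul] at h
  rw [h, add_sub_cancel_left]

end Walk

/-! ### The difference bridge. -/

section DifferenceBridge

variable {Ω : Type*} [MeasurableSpace Ω] {μ : Measure Ω} [IsProbabilityMeasure μ]
  {X : ℕ → Ω → EuclideanSpace ℝ (Fin 2)}

/-- The increments of the difference bridge. -/
noncomputable def centeredIncrement {Ω : Type*} {d : ℕ} (X : ℕ → Ω → EuclideanSpace ℝ (Fin d))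
    (N i : ℕ) (ω : Ω) : EuclideanSpace ℝ (Fin d) :=
  X i ω - (N : ℝ)⁻¹ • partialSum X N ω

theorem partialSum_centeredIncrement {Ω : Type*} {d : ℕ} (X : ℕ → Ω → EuclideanSpace ℝ (Fin d))
    (N k : ℕ) (ω : Ω) :
    partialSum (centeredIncrement X N) k ω = differenceBridge (partialSum X) N k ω := by
  simp only [partialSum, centeredIncrement, differenceBridge, Finset.sum_sub_distrib,
    Finset.sum_const, Finset.card_range, div_eq_mul_inv, mul_smul, Nat.cast_smul_eq_nsmul]

/-- Centering commutes with permutations, because the total sum is symmetric. -/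
theorem IsRandomWalkIncrements.isExchangeable_centeredIncrement
    (hX : IsRandomWalkIncrements μ X) (N : ℕ) : IsExchangeable μ N (centeredIncrement X N) := by
  intro σ hσ
  have hΦ : Measurable fun (y : Fin N → EuclideanSpace ℝ (Fin 2)) (i : Fin N) =>
      y i - (N : ℝ)⁻¹ • partialSum (extendZero N) N y :=
    measurable_pi_lambda _ fun i =>
      (measurable_pi_apply i).sub ((measurable_partialSum_extendZero N N).const_smul (N : ℝ)⁻¹)
  have h := ((hX.isExchangeable N) σ hσ).comp hΦ
  convert h using 1
  · funext ω i
    simp only [Function.comp_apply, partialSum_extendZero (fun i => X (σ i)) le_rfl,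
      centeredIncrement]
    rw [partialSum, partialSum, sum_range_bijOn hσ fun i => X i ω]
  · funext ω i
    simp only [Function.comp_apply, partialSum_extendZero X le_rfl, centeredIncrement]

theorem IsRandomWalkIncrements.ae_differenceBridge_ne_zero (hX : IsRandomWalkIncrements μ X)
    (hH : ChargesNoHyperplane μ (X 0)) {n k : ℕ} (hk : 0 < k) (hkn : k ≤ n) :
    ∀ᵐ ω ∂μ, differenceBridge (partialSum X) (n + 1) k ω ≠ 0 := by
  have ht : (k : ℝ) / ((n + 1 : ℕ) : ℝ) ≠ 0 := by positivity
  simpa only [differenceBridge, one_smul] using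
    hX.ae_smul_sub_smul_ne_zero hH (s := 1) (show k < n + 1 by omega) ht

/-- With `V = t S_i - s S_j`, the cross product equals `S_i × S_j - V × S_(n+1)`. It is affine in
the last increment `X n`, and `V` is a.s. nonzero. -/
theorem IsRandomWalkIncrements.ae_cross_differenceBridge_ne_zero
    (hX : IsRandomWalkIncrements μ X) (hH : ChargesNoHyperplane μ (X 0)) {n i j : ℕ} (hi : 0 < i)
    (hij : i < j) (hjn : j ≤ n) :
    ∀ᵐ ω ∂μ, planarCross (differenceBridge (partialSum X) (n + 1) i ω)
      (differenceBridge (partialSum X) (n + 1) j ω) ≠ 0 := by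
  have hin : i ≤ n := by omega
  have hs : (i : ℝ) / ((n + 1 : ℕ) : ℝ) ≠ 0 := by positivity
  set s : ℝ := (i : ℝ) / ((n + 1 : ℕ) : ℝ) with hs_def
  set t : ℝ := (j : ℝ) / ((n + 1 : ℕ) : ℝ) with ht_def
  have hpi := measurable_partialSum_extendZero n i
  have hpj := measurable_partialSum_extendZero n j
  have hpn := measurable_partialSum_extendZero n n
  have hV := (hpi.const_smul t).sub (hpj.const_smul s)
  have h := hX.ae_cross_ne hH hV
    ((measurable_planarCross.comp (hpi.prodMk hpj)).sub (measurable_planarCross.comp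
      (hV.prodMk hpn))) (by
      simpa only [Pi.sub_apply, Pi.smul_apply, partialSum_extendZero X hin,
        partialSum_extendZero X hjn] using hX.ae_smul_sub_smul_ne_zero hH hij hs)
  filter_upwards [h] with ω hω h'
  apply hω
  simp only [Pi.sub_apply, Pi.smul_apply, Function.comp_apply, partialSum_extendZero X hin,
    partialSum_extendZero X hjn, partialSum_extendZero X le_rfl]
  simp only [differenceBridge, ← hs_def, ← ht_def, partialSum_succ] at h'
  simp only [planarCross_apply, PiLp.sub_apply, PiLp.smul_apply, PiLp.add_apply,
    smul_eq_mul] at h' ⊢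
  linear_combination -h'

theorem measureReal_differenceBridge (hX : IsRandomWalkIncrements μ X)
    (hH : ChargesNoHyperplane μ (X 0)) {n : ℕ} (hn : 1 ≤ n) :
    μ.real {ω | (0 : EuclideanSpace ℝ (Fin 2)) ∉
        convexHull ℝ ((fun k => differenceBridge (partialSum X) (n + 1) k ω) '' Set.Icc 1 n)}
      = ∑ k ∈ Finset.Icc 1 n, 1 / ((k : ℝ) * ((n : ℝ) - (k : ℝ) + 1)) := by
  have h := measureReal_zero_notMem_convexHull (μ := μ) (Y := centeredIncrement X (n + 1)) hn
    (fun i => (hX.measurable i).sub ((measurable_partialSum hX.measurable (n + 1)).const_smul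
      ((n + 1 : ℕ) : ℝ)⁻¹))
    (hX.isExchangeable_centeredIncrement (n + 1))
  simp only [partialSum_centeredIncrement, Finset.mem_Icc] at h
  refine h (ae_of_all _ fun ω => ?_) (fun i hi => hX.ae_differenceBridge_ne_zero hH hi.1 hi.2)
    fun i hi j hj hij => ?_
  · rw [differenceBridge, div_self (by positivity), one_smul, sub_self]
  · rcases lt_or_gt_of_ne hij with hij | hij
    · exact hX.ae_cross_differenceBridge_ne_zero hH hi.1 hij hj.2
    · filter_upwards [hX.ae_cross_differenceBridge_ne_zero hH hj.1 hij hi.2] with ω hω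
      rw [planarCross_swap]
      exact neg_ne_zero.2 hω

end DifferenceBridge

/-! ### The conditional bridge. -/

section ConditionalBridge

/-- The vertices of the closed polygon through the origin and `w 0, ..., w (n - 1)`. -/
def polygonVertex {E : Type*} [Zero E] {n : ℕ} (w : Fin n → E) : ℕ → E
  | 0 => 0
  | k + 1 => extendZero n k w

/-- The `i`-th edge vector of the closed polygon through the origin and `w 0, ..., w (n - 1)`. -/
def polygonEdge {E : Type*} [AddGroup E] {n : ℕ} (i : ℕ) (w : Fin n → E) : E :=
  polygonVertex w (i + 1) - polygonVertex w i

theorem measurable_polygonVertex {E : Type*} [Zero E] [MeasurableSpace E] {n : ℕ} (k : ℕ) :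
    Measurable fun w : Fin n → E => polygonVertex w k := by
  cases k with
  | zero => exact measurable_const
  | succ k => exact measurable_extendZero n k

theorem measurable_polygonEdge {n d : ℕ} (i : ℕ) :
    Measurable (polygonEdge (E := EuclideanSpace ℝ (Fin d)) (n := n) i) :=
  (measurable_polygonVertex (i + 1)).sub (measurable_polygonVertex i)

theorem sum_polygonEdge {E : Type*} [AddCommGroup E] {n : ℕ} (w : Fin n → E) (k : ℕ) :
    ∑ i ∈ Finset.range k, polygonEdge i w = polygonVertex w k := by
  simp only [polygonEdge, Finset.sum_range_sub (polygonVertex w)]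
  exact sub_zero _

theorem polygonVertex_apply {E : Type*} [Zero E] {n k : ℕ} (B : ℕ → E) (hk : k ∈ Set.Icc 1 n) :
    polygonVertex (fun i : Fin n => B (i + 1)) k = B k := by
  obtain ⟨m, rfl⟩ := Nat.exists_eq_succ_of_ne_zero (Nat.one_le_iff_ne_zero.1 hk.1)
  have : m < n := hk.2
  simp [polygonVertex, extendZero, this]

theorem polygonVertex_partialSum {Ω E : Type*} [AddCommMonoid E] (X : ℕ → Ω → E) (ω : Ω) {n k : ℕ}
    (hk : k ≤ n) : polygonVertex (fun i : Fin n => partialSum X (i + 1) ω) k = partialSum X k ω := by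
  rcases Nat.eq_zero_or_pos k with rfl | h
  · simp [polygonVertex, partialSum]
  · exact polygonVertex_apply (fun k => partialSum X k ω) ⟨h, hk⟩

/-- Every edge but the last is an increment of the walk; the closing edge `-S_n` misses `X n` by
exactly `S_(n+1)`. -/
theorem dist_polygonEdge_partialSum_le {Ω : Type*} {d : ℕ} (X : ℕ → Ω → EuclideanSpace ℝ (Fin d))
    (ω : Ω) {n i : ℕ} (hi : i < n + 1) :
    dist (X i ω) (polygonEdge i fun i : Fin n => partialSum X (i + 1) ω)
      ≤ ‖partialSum X (n + 1) ω‖ := by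
  rw [polygonEdge, polygonVertex_partialSum X ω (Nat.le_of_lt_succ hi)]
  rcases (Nat.le_of_lt_succ hi).eq_or_lt with rfl | h
  · have : polygonVertex (fun l : Fin i => partialSum X (l + 1) ω) (i + 1) = 0 := by
      simp [polygonVertex, extendZero]
    rw [this, zero_sub, dist_eq_norm, sub_neg_eq_add, add_comm, partialSum_succ]
  · rw [polygonVertex_partialSum X ω h, partialSum_succ, add_sub_cancel_left, dist_self]
    exact norm_nonneg _

variable {Ω Ω' : Type*} [MeasurableSpace Ω] [MeasurableSpace Ω'] {μ : Measure Ω} {ν : Measure Ω'}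
  {n : ℕ}

/-- Conditioning preserves null sets, and a limit of zeros is zero; general position thus passes
from the walk to the bridge. -/
theorem IsConditionalBridge.measure_eq_zero {d : ℕ} {S : ℕ → Ω → EuclideanSpace ℝ (Fin d)}
    {B : ℕ → Ω' → EuclideanSpace ℝ (Fin d)} (hB : IsConditionalBridge μ ν n S B)
    {A : Set (Fin n → EuclideanSpace ℝ (Fin d))} (hA : MeasurableSet A)
    (h : μ {ω | (fun i : Fin n => S (i + 1) ω) ∈ A} = 0) :
    ν {ω' | (fun i : Fin n => B (i + 1) ω') ∈ A} = 0 := by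
  refine tendsto_nhds_unique (hB.tendsto_cond A hA) ?_
  simp only [fun s : Set Ω => cond_absolutelyContinuous (μ := μ) (s := s) h]
  exact tendsto_const_nhds

variable [IsProbabilityMeasure μ] [IsProbabilityMeasure ν]

/-- Given `‖S_(n+1)‖ ≤ r`, edges and increments are `r`-close, and the conditioning event is
permutation invariant. Exchangeability of the increments therefore transfers to the edges up to
thickening `F`. -/
theorem IsConditionalBridge.measure_polygonEdge_le {d : ℕ}
    {X : ℕ → Ω → EuclideanSpace ℝ (Fin d)} (hX : IsRandomWalkIncrements μ X)
    {B : ℕ → Ω' → EuclideanSpace ℝ (Fin d)} (hB : IsConditionalBridge μ ν n (partialSum X) B)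
    {σ τ : ℕ → ℕ} (hσ : Set.BijOn σ (Set.Iio (n + 1)) (Set.Iio (n + 1)))
    (hτ : Set.BijOn τ (Set.Iio (n + 1)) (Set.Iio (n + 1)))
    {F : Set (Fin (n + 1) → EuclideanSpace ℝ (Fin d))} (hF : IsClosed F) :
    ν {ω' | (fun l : Fin (n + 1) => polygonEdge (σ l) fun i : Fin n => B (i + 1) ω') ∈ F}
      ≤ ν {ω' | (fun l : Fin (n + 1) => polygonEdge (τ l) fun i : Fin n => B (i + 1) ω') ∈ F} := by
  have hedge : ∀ ρ : ℕ → ℕ, Measurable fun (w : Fin n → EuclideanSpace ℝ (Fin d))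
      (l : Fin (n + 1)) => polygonEdge (ρ l) w := fun ρ =>
    measurable_pi_lambda _ fun l => measurable_polygonEdge _
  have hBm : Measurable fun ω' (i : Fin n) => B (i + 1) ω' :=
    measurable_pi_lambda _ fun i => hB.measurable _ ⟨by omega, by omega⟩
  have hdist : ∀ ρ : ℕ → ℕ, Set.BijOn ρ (Set.Iio (n + 1)) (Set.Iio (n + 1)) → ∀ ω,
      dist (fun l : Fin (n + 1) => X (ρ l) ω)
        (fun l => polygonEdge (ρ l) fun i : Fin n => partialSum X (i + 1) ω)
        ≤ ‖partialSum X (n + 1) ω‖ := fun ρ hρ ω =>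
    (dist_pi_le_iff (norm_nonneg _)).2 fun l =>
      dist_polygonEdge_partialSum_le X ω (hρ.mapsTo l.2)
  have hthick : ∀ δ : ℝ, 0 < δ →
      ν {ω' | (fun l : Fin (n + 1) => polygonEdge (σ l) fun i : Fin n => B (i + 1) ω') ∈ F}
      ≤ ν {ω' | (fun l : Fin (n + 1) => polygonEdge (τ l) fun i : Fin n => B (i + 1) ω')
          ∈ Metric.cthickening δ F} := by
    intro δ hδ
    refine le_of_tendsto_of_tendsto (hB.tendsto_cond _ (hedge σ hF.measurableSet))
      (hB.tendsto_cond _ (hedge τ Metric.isClosed_cthickening.measurableSet)) ?_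
    -- Half of `δ`, since `F` is thickened by `r` twice: from edges to increments and back.
    filter_upwards [Ioc_mem_nhdsGT (half_pos hδ)] with r hr
    have hH : MeasurableSet {ω | ‖partialSum X (n + 1) ω‖ ≤ r} :=
      measurableSet_le (measurable_partialSum hX.measurable _).norm measurable_const
    rw [cond_apply hH, cond_apply hH]
    gcongr 1
    have hK : MeasurableSet {y : Fin (n + 1) → EuclideanSpace ℝ (Fin d) |
        ‖partialSum (extendZero (n + 1)) (n + 1) y‖ ≤ r ∧ y ∈ Metric.cthickening r F} :=
      (measurableSet_le (measurable_partialSum (fun i => measurable_extendZero _ i) _).norm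
        measurable_const).inter Metric.isClosed_cthickening.measurableSet
    have hsum : ∀ ρ : ℕ → ℕ, Set.BijOn ρ (Set.Iio (n + 1)) (Set.Iio (n + 1)) → ∀ ω,
        partialSum (extendZero (n + 1)) (n + 1) (fun l : Fin (n + 1) => X (ρ l) ω)
          = partialSum X (n + 1) ω := fun ρ hρ ω => by
      rw [partialSum_extendZero (fun l => X (ρ l)) le_rfl, partialSum, partialSum,
        sum_range_bijOn hρ fun i => X i ω]
    have hexch := hX.isExchangeable (n + 1)
    calc _ ≤ μ ((fun ω (l : Fin (n + 1)) => X (σ l) ω) ⁻¹'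
          {y | ‖partialSum (extendZero (n + 1)) (n + 1) y‖ ≤ r ∧ y ∈ Metric.cthickening r F}) := by
          refine measure_mono fun ω hω => ⟨?_, ?_⟩
          · rw [hsum σ hσ]
            exact hω.1
          · exact Metric.mem_cthickening_of_dist_le _ _ _ _ hω.2 ((hdist σ hσ ω).trans hω.1)
      _ = μ ((fun ω (l : Fin (n + 1)) => X (τ l) ω) ⁻¹'
          {y | ‖partialSum (extendZero (n + 1)) (n + 1) y‖ ≤ r ∧ y ∈ Metric.cthickening r F}) :=
          ((hexch σ hσ).trans (hexch τ hτ).symm).measure_mem_eq hK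
      _ ≤ _ := by
          refine measure_mono fun ω hω => ?_
          have h1 : ‖partialSum X (n + 1) ω‖ ≤ r := by
            rw [← hsum τ hτ]
            exact hω.1
          refine ⟨h1, ?_⟩
          have h2 := Metric.mem_cthickening_of_dist_le _ _ r _ hω.2
            ((dist_comm _ _).trans_le ((hdist τ hτ ω).trans h1))
          have h3 := Metric.cthickening_cthickening_subset hr.1.le hr.1.le F h2
          exact Metric.cthickening_mono (by linarith [hr.2]) F h3
  have hmeas := (hedge τ).comp hBm
  -- Now `δ → 0`; closedness of `F` makes the thickenings shrink to `F`.
  have hlim := tendsto_measure_cthickening_of_isClosed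
    (μ := ν.map ((fun (w : Fin n → EuclideanSpace ℝ (Fin d)) (l : Fin (n + 1)) =>
      polygonEdge (τ l) w) ∘ fun ω' (i : Fin n) => B (i + 1) ω'))
    ⟨1, one_pos, measure_ne_top _ _⟩ hF
  rw [Measure.map_apply hmeas hF.measurableSet] at hlim
  refine ge_of_tendsto (hlim.mono_left nhdsWithin_le_nhds : Tendsto _ (𝓝[>] (0 : ℝ)) _) ?_
  filter_upwards [self_mem_nhdsWithin] with δ hδ
  rw [Measure.map_apply hmeas Metric.isClosed_cthickening.measurableSet]
  exact hthick δ hδ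

theorem IsConditionalBridge.isExchangeable {d : ℕ} {X : ℕ → Ω → EuclideanSpace ℝ (Fin d)}
    (hX : IsRandomWalkIncrements μ X) {B : ℕ → Ω' → EuclideanSpace ℝ (Fin d)}
    (hB : IsConditionalBridge μ ν n (partialSum X) B) :
    IsExchangeable ν (n + 1) fun l ω' => polygonEdge l fun i : Fin n => B (i + 1) ω' := by
  intro σ hσ
  have hid : Set.BijOn id (Set.Iio (n + 1)) (Set.Iio (n + 1)) := Set.bijOn_id _
  have hBm : Measurable fun ω' (i : Fin n) => B (i + 1) ω' :=
    measurable_pi_lambda _ fun i => hB.measurable _ ⟨by omega, by omega⟩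
  have hm : ∀ ρ : ℕ → ℕ, Measurable fun ω' (l : Fin (n + 1)) =>
      polygonEdge (ρ l) fun i : Fin n => B (i + 1) ω' := fun ρ =>
    measurable_pi_lambda _ fun l => (measurable_polygonEdge _).comp hBm
  refine ⟨(hm σ).aemeasurable, (hm id).aemeasurable, ?_⟩
  have : IsProbabilityMeasure (ν.map fun ω' (l : Fin (n + 1)) =>
      polygonEdge (σ l) fun i : Fin n => B (i + 1) ω') :=
    Measure.isProbabilityMeasure_map (hm σ).aemeasurable
  have : IsProbabilityMeasure (ν.map fun ω' (l : Fin (n + 1)) =>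
      polygonEdge l fun i : Fin n => B (i + 1) ω') :=
    Measure.isProbabilityMeasure_map (hm id).aemeasurable
  -- Closed sets form a generating π-system; the inequality used in both directions gives equality
  -- on them.
  refine ext_of_generate_finite _
    (by rw [BorelSpace.measurable_eq (α := Fin (n + 1) → EuclideanSpace ℝ (Fin d)),
      borel_eq_generateFrom_isClosed]) isPiSystem_isClosed (fun F hF => ?_) (by simp)
  rw [Measure.map_apply (hm σ) hF.measurableSet]
  refine Eq.trans ?_ (Measure.map_apply (hm id) hF.measurableSet).symm
  exact le_antisymm (hB.measure_polygonEdge_le hX hσ hid hF)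
    (hB.measure_polygonEdge_le hX hid hσ hF)

theorem IsConditionalBridge.measureReal {X : ℕ → Ω → EuclideanSpace ℝ (Fin 2)}
    (hX : IsRandomWalkIncrements μ X) (hH : ChargesNoHyperplane μ (X 0)) (hn : 1 ≤ n)
    {B : ℕ → Ω' → EuclideanSpace ℝ (Fin 2)} (hB : IsConditionalBridge μ ν n (partialSum X) B) :
    ν.real {ω' | (0 : EuclideanSpace ℝ (Fin 2)) ∉ convexHull ℝ ((fun k => B k ω') '' Set.Icc 1 n)}
      = ∑ k ∈ Finset.Icc 1 n, 1 / ((k : ℝ) * ((n : ℝ) - (k : ℝ) + 1)) := by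
  have hBm : Measurable fun ω' (i : Fin n) => B (i + 1) ω' :=
    measurable_pi_lambda _ fun i => hB.measurable _ ⟨by omega, by omega⟩
  have hsum : ∀ k ω', partialSum (fun l ω' => polygonEdge l fun i : Fin n => B (i + 1) ω') k ω'
      = polygonVertex (fun i : Fin n => B (i + 1) ω') k := fun k ω' => sum_polygonEdge _ k
  have hcross : ∀ i j, 0 < i → i < j → j ≤ n → ∀ᵐ ω' ∂ν,
      planarCross (polygonVertex (fun l : Fin n => B (l + 1) ω') i)
        (polygonVertex (fun l : Fin n => B (l + 1) ω') j) ≠ 0 := by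
    intro i j hi hij hj
    refine measure_eq_zero_iff_ae_notMem.1 (hB.measure_eq_zero
      (A := {w | planarCross (polygonVertex w i) (polygonVertex w j) = 0})
      (measurable_planarCross.comp ((measurable_polygonVertex i).prodMk
        (measurable_polygonVertex j)) (measurableSet_singleton 0)) ?_)
    simp only [Set.mem_ofPred_eq, polygonVertex_partialSum X _ (hij.le.trans hj),
      polygonVertex_partialSum X _ hj]
    exact measure_eq_zero_iff_ae_notMem.2 (hX.ae_cross_partialSum_ne_zero hH hi hij)
  have h := measureReal_zero_notMem_convexHull (μ := ν)
    (Y := fun l ω' => polygonEdge l fun i : Fin n => B (i + 1) ω') hn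
    (fun l => (measurable_polygonEdge l).comp hBm) (hB.isExchangeable hX)
  simp only [hsum, Finset.mem_Icc] at h
  have hset : ∀ ω', (fun k => polygonVertex (fun i : Fin n => B (i + 1) ω') k) '' Set.Icc 1 n
      = (fun k => B k ω') '' Set.Icc 1 n := fun ω' =>
    Set.image_congr fun k hk => polygonVertex_apply (fun k => B k ω') hk
  simp only [hset] at h
  refine h (ae_of_all _ fun ω' => ?_) (fun i hi => ?_) fun i hi j hj hij => ?_
  -- Vertex `n + 1` is out of range, so its default value zero closes the polygon.
  · simp [polygonVertex, extendZero]
  · refine measure_eq_zero_iff_ae_notMem.1 (hB.measure_eq_zero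
      (A := {w | polygonVertex w i = 0})
      (measurable_polygonVertex i (measurableSet_singleton 0)) ?_)
    simp only [Set.mem_ofPred_eq, polygonVertex_partialSum X _ hi.2]
    exact measure_eq_zero_iff_ae_notMem.2 (hX.ae_partialSum_ne_zero hH hi.1)
  · rcases lt_or_gt_of_ne hij with hij | hij
    · exact hcross i j hi.1 hij hj.2
    · filter_upwards [hcross j i hj.1 hij hi.2] with ω' hω'
      rw [planarCross_swap]
      exact neg_ne_zero.2 hω'

end ConditionalBridge

theorem theorem3 {Ω : Type*} [MeasurableSpace Ω] (μ : Measure Ω) [IsProbabilityMeasure μ]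
    (X : ℕ → Ω → EuclideanSpace ℝ (Fin 2)) (hX : IsRandomWalkIncrements μ X)
    (hH : ChargesNoHyperplane μ (X 0)) (n : ℕ) (hn : 1 ≤ n) :
    (μ.real {ω | (0 : EuclideanSpace ℝ (Fin 2)) ∉
        convexHull ℝ ((fun k => differenceBridge (partialSum X) (n + 1) k ω) '' Set.Icc 1 n)}
      = ∑ k ∈ Finset.Icc 1 n, 1 / ((k : ℝ) * ((n : ℝ) - (k : ℝ) + 1))) ∧
    (∀ {Ω' : Type*} [MeasurableSpace Ω'] (ν : Measure Ω') [IsProbabilityMeasure ν]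
        (B : ℕ → Ω' → EuclideanSpace ℝ (Fin 2)),
      IsConditionalBridge μ ν n (partialSum X) B →
      ν.real {ω' | (0 : EuclideanSpace ℝ (Fin 2)) ∉
          convexHull ℝ ((fun k => B k ω') '' Set.Icc 1 n)}
        = ∑ k ∈ Finset.Icc 1 n, 1 / ((k : ℝ) * ((n : ℝ) - (k : ℝ) + 1))) :=
  ⟨measureReal_differenceBridge hX hH hn, fun _ _ _ hB => hB.measureReal hX hH hn⟩
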